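/- Let $\Lambda$ be a finite-dimensional algebra over a field, and let $\operatorname{proj}\Lambda$ be the category of finitely generated projective right $\Lambda$-modules. For $n\ge 2$ let $C_n(\operatorname{proj}\Lambda)$ be the category of cochain complexes $X$ over $\operatorname{proj}\Lambda$ with $X^i=0$ for $i\notin\{1,\dots,n\}$, and let $K^b(\operatorname{proj}\Lambda)$ be the homotopy category of the category $C^b(\operatorname{proj}\Lambda)$ of bounded complexes. For $0\neq X\in K^b(\operatorname{proj}\Lambda)$ let $\bar X\in C^b(\operatorname{proj}\Lambda)$ be the (up to isomorphism unique) bounded complex isomorphic to $X$ in $K^b(\operatorname{proj}\Lambda)$ that has no direct summand of the form $\cdots\to 0\to P\xrightarrow{\,1\,}P\to 0\to\cdots$ with $P$ indecomposable projective; if $\bar X^r\ne 0\ne \bar X^s$ and $\bar X^i=0$ for $i<r$ and for $i>s$, put $\ell(X)=s-r$. The strong global dimension of $\Lambda$ is $$\operatorname{s.gl.dim}(\Lambda)=\sup\{\ell(X)\mid X\in K^b(\operatorname{proj}\Lambda)\text{ indecomposable}\}\in\mathbb N\cup\{\infty\}$$ (with $\sup\emptyset=0$). Theorem. If $\operatorname{s.gl.dim}(\Lambda)\ge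 1$, then $$\operatorname{s.gl.dim}(\Lambda)=m_0-2,\qquad m_0=\min\{n\ge 2\mid \text{every indecomposable } X\in C_n(\operatorname{proj}\Lambda)\text{ has } X^1=0\text{ or }X^n=0\},$$ where $m_0=\infty$ if there is no such $n$, and $\infty-2=\infty$. In particular $\operatorname{s.gl.dim}(\Lambda)=\infty$ if and only if no such $n$ exists. -/

import Mathlib

open CategoryTheory CategoryTheory.Limits

universe w v u

namespace StrongGlDim

/-- A full subcategory of a preadditive category has binary biproducts as soon as any two of its
objects have, in the ambient category, a biproduct that lies in the subcategory. -/
theorem hasBinaryBiproducts_fullSubcategory {C : Type u} [Category.{v} C] [Preadditive C]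
    (P : ObjectProperty C)
    (h : ∀ X Y : C, P X → P Y → ∃ b : BinaryBicone X Y, P b.pt ∧ Nonempty b.IsBilimit) :
    HasBinaryBiproducts P.FullSubcategory where
  has_binary_biproduct X Y := by
    obtain ⟨b, hb, ⟨hl⟩⟩ := h X.obj Y.obj X.property Y.property
    exact hasBinaryBiproduct_of_total (C := P.FullSubcategory)
      { pt := ⟨b.pt, hb⟩
        fst := P.homMk b.fst
        snd := P.homMk b.snd
        inl := P.homMk b.inl
        inr := P.homMk b.inr
        inl_fst := by ext; exact b.inl_fst
        inl_snd := by ext; exact b.inl_snd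
        inr_fst := by ext; exact b.inr_fst
        inr_snd := by ext; exact b.inr_snd }
      (by ext; exact IsBilimit.binary_total hl)

section Algebra

variable (Λ : Type u) [Ring Λ]

/-- The finitely generated projective modules among the right `Λ`-modules
(a right `Λ`-module is a left module over the opposite ring). -/
def isFinProj : ObjectProperty (ModuleCat.{u} Λᵐᵒᵖ) :=
  fun M => Module.Finite Λᵐᵒᵖ M ∧ Module.Projective Λᵐᵒᵖ M

/-- The category `proj Λ` of finitely generated projective right `Λ`-modules. -/
abbrev ProjCat : Type (u + 1) := (isFinProj Λ).FullSubcategory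

instance : (isFinProj Λ).ContainsZero where
  exists_zero := ⟨ModuleCat.of Λᵐᵒᵖ PUnit, ModuleCat.isZero_of_subsingleton _,
    inferInstanceAs (Module.Finite Λᵐᵒᵖ PUnit.{u + 1}),
    inferInstanceAs (Module.Projective Λᵐᵒᵖ PUnit.{u + 1})⟩

instance : HasBinaryBiproducts (ProjCat Λ) :=
  hasBinaryBiproducts_fullSubcategory _ fun X Y hX hY =>
    ⟨BinaryBiproduct.bicone X Y, by
      have := hX.1
      have := hX.2
      have := hY.1
      have := hY.2
      let e : (X ⊞ Y : ModuleCat Λᵐᵒᵖ) ≃ₗ[Λᵐᵒᵖ] (X × Y) :=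
        (ModuleCat.biprodIsoProd X Y).toLinearEquiv
      exact ⟨Module.Finite.equiv e.symm, Module.Projective.of_equiv e.symm⟩,
      ⟨BinaryBiproduct.isBilimit X Y⟩⟩

/-- Cochain complexes `X`, indexed by `ℤ`, of finitely generated projective right `Λ`-modules. -/
abbrev ProjComplex : Type (u + 1) := CochainComplex (ProjCat Λ) ℤ

variable {Λ} in
/-- The cells of `X` vanish outside the degrees `r, …, s`. -/
def VanishesOutside (X : ProjComplex Λ) (r s : ℤ) : Prop :=
  ∀ i : ℤ, i < r ∨ s < i → IsZero (X.X i)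

variable {Λ} in
theorem VanishesOutside.biprod {X Y : ProjComplex Λ} {r s r' s' : ℤ}
    (hX : VanishesOutside X r s) (hY : VanishesOutside Y r' s') :
    VanishesOutside (X ⊞ Y) (min r r') (max s s') := by
  intro i hi
  refine IsZero.of_iso ?_ ((HomologicalComplex.eval (ProjCat Λ) (.up ℤ) i).mapBiprod X Y)
  rw [biprod_isZero_iff]
  exact ⟨hX i (by omega), hY i (by omega)⟩

/-- The complexes of fixed size `n`: those concentrated in the degrees `1, …, n`. -/
def isFixedSize (n : ℕ) : ObjectProperty (ProjComplex Λ) :=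
  fun X => VanishesOutside X 1 n

/-- The category `C_n(proj Λ)`. Its objects are the complexes `X¹ ⟶ X² ⟶ ⋯ ⟶ Xⁿ`. -/
abbrev FixedSizeComplex (n : ℕ) : Type (u + 1) := (isFixedSize Λ n).FullSubcategory

instance (n : ℕ) : HasBinaryBiproducts (FixedSizeComplex Λ n) :=
  hasBinaryBiproducts_fullSubcategory _ fun X Y hX hY =>
    ⟨BinaryBiproduct.bicone X Y, by
      have h := VanishesOutside.biprod hX hY
      simp only [min_self, max_self] at h
      exact h, ⟨BinaryBiproduct.isBilimit X Y⟩⟩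

/-- The bounded complexes. -/
def isBounded : ObjectProperty (ProjComplex Λ) :=
  fun X => ∃ r s : ℤ, VanishesOutside X r s

/-- The category `C^b(proj Λ)`. -/
abbrev BoundedComplex : Type (u + 1) := (isBounded Λ).FullSubcategory

instance : HasBinaryBiproducts (BoundedComplex Λ) :=
  hasBinaryBiproducts_fullSubcategory _ fun X Y ⟨_, _, hX⟩ ⟨_, _, hY⟩ =>
    ⟨BinaryBiproduct.bicone X Y, ⟨_, _, VanishesOutside.biprod hX hY⟩,
      ⟨BinaryBiproduct.isBilimit X Y⟩⟩

/-- The objects of the homotopy category which are bounded complexes. -/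
def isHoBounded : ObjectProperty (HomotopyCategory (ProjCat Λ) (.up ℤ)) :=
  (isBounded Λ).strictMap (HomotopyCategory.quotient (ProjCat Λ) (.up ℤ))

/-- The category `K^b(proj Λ)`: bounded complexes, with homotopy classes of morphisms. -/
abbrev HoBounded : Type (u + 1) := (isHoBounded Λ).FullSubcategory

/-- The functor `C^b(proj Λ) ⥤ K^b(proj Λ)`. -/
noncomputable abbrev toHo : BoundedComplex Λ ⥤ HoBounded Λ :=
  (isHoBounded Λ).lift ((isBounded Λ).ι ⋙ HomotopyCategory.quotient (ProjCat Λ) (.up ℤ))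
    (fun X => ⟨X.obj, X.property⟩)

instance : HasBinaryBiproducts (HoBounded Λ) :=
  hasBinaryBiproducts_fullSubcategory _ fun X Y hX hY => by
    obtain ⟨K, hK⟩ := hX
    obtain ⟨L, hL⟩ := hY
    obtain ⟨r, s, h⟩ := hK
    obtain ⟨r', s', h'⟩ := hL
    exact ⟨(HomotopyCategory.quotient (ProjCat Λ) (.up ℤ)).mapBinaryBicone
        (BinaryBiproduct.bicone K L),
      ⟨K ⊞ L, ⟨_, _, VanishesOutside.biprod h h'⟩⟩,
      ⟨isBinaryBilimitOfTotal _ (by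
        have h := congrArg (HomotopyCategory.quotient (ProjCat Λ) (.up ℤ)).map
          (biprod.total (X := K) (Y := L))
        simp only [Functor.map_add, Functor.map_comp] at h
        exact h)⟩⟩

variable {Λ}

/-- The complex `J_k(P)`, which is the identity `P ⟶ P` placed in the degrees `k` and `k + 1`. -/
noncomputable def J (P : ProjCat Λ) (k : ℤ) : BoundedComplex Λ where
  obj := HomologicalComplex.double (𝟙 P) (show (ComplexShape.up ℤ).Rel k (k + 1) from rfl)
  property := ⟨k, k + 1, fun i hi =>
    HomologicalComplex.isZero_double_X _ _ i (by omega) (by omega)⟩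

/-- `Y` has no indecomposable projective direct summand in `C^b(proj Λ)`. Projectivity is meant for
the exact structure given by the degreewise split sequences; the indecomposable projectives
are the complexes `J_k(P)` with `P` an indecomposable projective module and `k : ℤ`. -/
def HasNoProjectiveSummand (Y : BoundedComplex Λ) : Prop :=
  ∀ (P : ProjCat Λ) (k : ℤ), Indecomposable P →
    ¬ ∃ Z : BoundedComplex Λ, Nonempty (Y ≅ J P k ⊞ Z)

/-- `ℓ(X) = l`: the object `X` of `K^b(proj Λ)` has a preimage `Y` in `C^b(proj Λ)` without
indecomposable projective direct summands (such a `Y` is unique up to isomorphism), the first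
nonzero cell of `Y` is in degree `r`, the last one is in degree `s`, and `l = s - r`. -/
def HasLength (X : HoBounded Λ) (l : ℕ) : Prop :=
  ∃ (Y : BoundedComplex Λ) (r s : ℤ), Nonempty ((toHo Λ).obj Y ≅ X) ∧ HasNoProjectiveSummand Y ∧
    ¬ IsZero (Y.obj.X r) ∧ ¬ IsZero (Y.obj.X s) ∧ VanishesOutside Y.obj r s ∧ (l : ℤ) = s - r

variable (Λ)

/-- The strong global dimension: the supremum of the lengths of the indecomposable objects of
`K^b(proj Λ)`. -/
noncomputable def sgldim : ℕ∞ :=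
  sSup {N : ℕ∞ | ∃ (X : HoBounded Λ) (l : ℕ), Indecomposable X ∧ HasLength X l ∧ N = l}

/-- The least `n ≥ 2` such that every indecomposable complex in `C_n(proj Λ)` has its first or its
`n`-th cell equal to zero; it is `∞` if there is no such `n`. -/
noncomputable def m₀ : ℕ∞ :=
  sInf {N : ℕ∞ | ∃ n : ℕ, 2 ≤ n ∧
    (∀ X : FixedSizeComplex Λ n, Indecomposable X → IsZero (X.obj.X 1) ∨ IsZero (X.obj.X n)) ∧
    N = n}

end Algebra

end StrongGlDim

/-!
An indecomposable bounded complex is either contractible, in which case it is some `J_k(P)`, or it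
has no indecomposable projective summand and stays indecomposable in the homotopy category. So the
lengths in the strong global dimension are, up to a shift, the numbers `n - 1` for which some
indecomposable complex that is not a `J_k(P)` lives in the degrees `1, …, n` and is nonzero in
both end degrees.

* `indecomposable_toHo` and `hasTrivialIdempotents_of_indecomposable_toHo` compare indecomposability
  in `C^b(proj Λ)` and `K^b(proj Λ)`. They rest on Fitting's lemma for bounded complexes
  (`isIso_or_pow_eq_zero`) and on the fact that the last differential of a contractible complex
  splits, which gives a summand `J_k(P)` (`isZero_of_retract_of_isZero_toHo`).
* `exists_hasLength`: an indecomposable complex that is nonzero in the degrees `1` and `n ≥ 3`, and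
  zero outside `1, …, n`, has too many degrees to be a `J_k(P)`, so `n - 1` is a length. Hence, if
  the strong global dimension is a number `L ≥ 1`, every indecomposable complex in `C_{L + 2}(proj Λ)`
  vanishes in degree `1` or `L + 2`.
* `exists_indecomposable_fixedSize`: an indecomposable complex `K` that fills the degrees `1, …, m`
  yields one that fills `1, …, n` for each `n ≤ m`. In the brutal truncation of `K` to the degrees
  `≤ n`, take an indecomposable summand `A` with `A¹ ≠ 0`. If `Aⁿ` were zero, the inclusion of `A`
  would lift to `K`, so that `A` would be a summand of `K`, hence all of `K`, against `Kᵐ ≠ 0`.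
  Therefore a length `l` excludes every `n ≤ l + 1` from the minimum `m₀`.
-/

namespace StrongGlDim

/-! ### Direct summands in preadditive categories -/

section Preadditive

variable {C : Type u} [Category.{v} C] [Preadditive C]

/-- A decomposition of the identity of `X` through retracts `A` and `B` exhibits `X` as their
biproduct. -/
theorem nonempty_iso_biprod_of_total [HasBinaryBiproducts C] {X A B : C}
    (a : Retract A X) (b : Retract B X) (h : a.r ≫ a.i + b.r ≫ b.i = 𝟙 X) :
    Nonempty (X ≅ A ⊞ B) := by
  have hab : a.i ≫ b.r = 0 := by
    have := a.i ≫= h =≫ b.r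
    simpa using this
  have hba : b.i ≫ a.r = 0 := by
    have := b.i ≫= h =≫ a.r
    simpa using this
  exact ⟨{ hom := biprod.lift a.r b.r
           inv := biprod.desc a.i b.i
           hom_inv_id := by simpa using h
           inv_hom_id := by ext <;> simp [hab, hba] }⟩

/-- In an idempotent complete category, a retract is a direct summand. -/
theorem exists_iso_biprod_of_retract [HasBinaryBiproducts C] [IsIdempotentComplete C] {X A : C}
    (a : Retract A X) : ∃ B : C, Nonempty (X ≅ A ⊞ B) := by
  obtain ⟨B, i, r, hir, hri⟩ := IsIdempotentComplete.idempotents_split X (𝟙 X - a.r ≫ a.i)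
    (Idempotents.idem_of_id_sub_idem _ (by simp))
  exact ⟨B, nonempty_iso_biprod_of_total a ⟨i, r, hir⟩ (by simp [hri])⟩

theorem indecomposable_of_iso [HasBinaryBiproducts C] {X Y : C} (e : X ≅ Y)
    (h : Indecomposable X) : Indecomposable Y :=
  ⟨fun hY => h.1 (hY.of_iso e), fun A B φ => h.2 A B (e ≪≫ φ)⟩

/-- Every idempotent endomorphism of `X` is zero or the identity. For nonzero objects of an
idempotent complete category this is indecomposability, but it depends on the endomorphism ring only, so it
passes along fully faithful functors. Zero objects satisfy it. -/
def HasTrivialIdempotents (X : C) : Prop :=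
  ∀ e : X ⟶ X, e ≫ e = e → e = 0 ∨ e = 𝟙 X

theorem HasTrivialIdempotents.indecomposable [HasBinaryBiproducts C] {X : C}
    (h : HasTrivialIdempotents X) (hX : ¬ IsZero X) : Indecomposable X := by
  refine ⟨hX, fun A B e => ?_⟩
  rcases h (e.hom ≫ biprod.fst ≫ biprod.inl ≫ e.inv) (by simp) with h | h
  · left
    have := (biprod.inl ≫ e.inv) ≫= h =≫ (e.hom ≫ biprod.fst)
    rw [IsZero.iff_id_eq_zero]
    simpa using this
  · right
    have := (biprod.inr ≫ e.inv) ≫= h =≫ (e.hom ≫ biprod.snd)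
    rw [IsZero.iff_id_eq_zero]
    simpa using this.symm

theorem hasTrivialIdempotents_of_indecomposable [HasBinaryBiproducts C] [IsIdempotentComplete C]
    {X : C} (h : Indecomposable X) : HasTrivialIdempotents X := by
  intro e he
  obtain ⟨A, i, r, hir, hri⟩ := IsIdempotentComplete.idempotents_split X e he
  obtain ⟨B, i', r', hir', hri'⟩ := IsIdempotentComplete.idempotents_split X (𝟙 X - e)
    (Idempotents.idem_of_id_sub_idem _ he)
  obtain ⟨φ⟩ := nonempty_iso_biprod_of_total (X := X) ⟨i, r, hir⟩ ⟨i', r', hir'⟩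
    (by simp [hri, hri'])
  rcases h.2 A B φ with hA | hB
  · left
    rw [← hri, hA.eq_of_src i 0, comp_zero]
  · right
    rw [hB.eq_of_src i' 0, comp_zero] at hri'
    exact (sub_eq_zero.mp hri'.symm).symm

/-- A nonzero retract of an object with trivial idempotents is the whole object. -/
theorem HasTrivialIdempotents.nonempty_iso_of_retract {X A : C} (h : HasTrivialIdempotents X)
    (a : Retract A X) (hA : ¬ IsZero A) : Nonempty (A ≅ X) := by
  rcases h (a.r ≫ a.i) (by simp) with h | h
  · refine absurd ?_ hA
    rw [IsZero.iff_id_eq_zero]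
    have := a.i ≫= h =≫ a.r
    simpa using this
  · exact ⟨a.i, a.r, a.retract, h⟩

theorem HasTrivialIdempotents.of_fullyFaithful {D : Type*} [Category* D] [Preadditive D]
    (F : C ⥤ D) [F.Full] [F.Faithful] [F.Additive] {X : C} (h : HasTrivialIdempotents X) :
    HasTrivialIdempotents (F.obj X) := by
  intro e he
  obtain ⟨e, rfl⟩ := F.map_surjective e
  rw [← F.map_comp] at he
  rcases h e (F.map_injective he) with rfl | rfl <;> simp

theorem HasTrivialIdempotents.of_map {D : Type*} [Category* D] [Preadditive D]
    (F : C ⥤ D) [F.Faithful] [F.Additive] {X : C} (h : HasTrivialIdempotents (F.obj X)) :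
    HasTrivialIdempotents X := by
  intro e he
  rcases h (F.map e) (by rw [← F.map_comp, he]) with h | h
  · exact .inl (F.map_injective (by simpa using h))
  · exact .inr (F.map_injective (by simpa using h))

/-- An object with an additive, faithful `ℕ`-valued size has an indecomposable direct summand;
the summand can be chosen with any property `Q` of nonzero objects that a biproduct can only have
if one of its summands has it. -/
theorem exists_indecomposable_retract [HasBinaryBiproducts C] (size : C → ℕ)
    (size_add : ∀ {A B D : C}, (A ≅ B ⊞ D) → size A = size B + size D)
    (size_zero : ∀ {A : C}, size A = 0 → IsZero A) (Q : C → Prop)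
    (hQ : ∀ {A B D : C}, (A ≅ B ⊞ D) → Q A → Q B ∨ Q D)
    (hQ₀ : ∀ {A : C}, Q A → ¬ IsZero A) (X : C) (hX : Q X) :
    ∃ A : C, Nonempty (Retract A X) ∧ Indecomposable A ∧ Q A := by
  induction hn : size X using Nat.strong_induction_on generalizing X with
  | _ n ih =>
    subst hn
    by_cases hI : Indecomposable X
    · exact ⟨X, ⟨Retract.refl X⟩, hI, hX⟩
    · simp only [Indecomposable, not_and, not_forall, not_or] at hI
      obtain ⟨B, D, e, hB, hD⟩ := hI (hQ₀ hX)
      have hB' : size B ≠ 0 := fun h => hB (size_zero h)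
      have hD' : size D ≠ 0 := fun h => hD (size_zero h)
      have := size_add e
      rcases hQ e hX with h | h
      · obtain ⟨A, ⟨a⟩, hA⟩ := ih (size B) (by omega) B h rfl
        exact ⟨A, ⟨a.trans ⟨biprod.inl ≫ e.inv, e.hom ≫ biprod.fst, by simp⟩⟩, hA⟩
      · obtain ⟨A, ⟨a⟩, hA⟩ := ih (size D) (by omega) D h rfl
        exact ⟨A, ⟨a.trans ⟨biprod.inr ≫ e.inv, e.hom ≫ biprod.snd, by simp⟩⟩, hA⟩

omit [Preadditive C] in
theorem isIdempotentComplete_fullSubcategory [IsIdempotentComplete C] (P : ObjectProperty C)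
    (hP : ∀ {X Y : C}, Retract Y X → P X → P Y) : IsIdempotentComplete P.FullSubcategory where
  idempotents_split X e he := by
    obtain ⟨Y, i, r, hir, hri⟩ := IsIdempotentComplete.idempotents_split X.obj e.hom
      (congrArg (·.hom) he)
    exact ⟨⟨Y, hP ⟨i, r, hir⟩ X.property⟩, P.homMk i, P.homMk r, by ext; exact hir,
      by ext; exact hri⟩

theorem isZero_of_retract {X A : C} (a : Retract A X) (hX : IsZero X) : IsZero A := by
  rw [IsZero.iff_id_eq_zero, ← a.retract, hX.eq_of_src a.r 0, comp_zero]

end Preadditive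

/-! ### Idempotent completeness of the categories of complexes -/

section Algebra

variable {Λ : Type u} [Ring Λ]

theorem isFinProj_of_retract {M N : ModuleCat.{u} Λᵐᵒᵖ} (a : Retract N M) (h : isFinProj Λ M) :
    isFinProj Λ N := by
  have h₁ := h.1
  have h₂ := h.2
  have hs : a.r.hom ∘ₗ a.i.hom = LinearMap.id := by
    rw [← ModuleCat.hom_comp, a.retract, ModuleCat.hom_id]
  exact ⟨Module.Finite.of_surjective a.r.hom fun x => ⟨a.i.hom x, LinearMap.congr_fun hs x⟩,
    Module.Projective.of_split a.i.hom a.r.hom hs⟩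

theorem VanishesOutside.of_retract {X Y : ProjComplex Λ} (a : Retract Y X) {r s : ℤ}
    (h : VanishesOutside X r s) : VanishesOutside Y r s :=
  fun i hi => isZero_of_retract (a.map (HomologicalComplex.eval _ _ i)) (h i hi)

instance : IsIdempotentComplete (ProjCat Λ) :=
  isIdempotentComplete_fullSubcategory _ isFinProj_of_retract

instance : IsIdempotentComplete (BoundedComplex Λ) :=
  isIdempotentComplete_fullSubcategory _ fun a ⟨r, s, h⟩ => ⟨r, s, h.of_retract a⟩

instance (n : ℕ) : IsIdempotentComplete (FixedSizeComplex Λ n) :=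
  isIdempotentComplete_fullSubcategory _ fun a h => VanishesOutside.of_retract a h

instance : (toHo Λ).Additive where
  map_add := by
    intros
    ext
    exact Functor.map_add (HomotopyCategory.quotient (ProjCat Λ) (.up ℤ))

instance : (toHo Λ).Full where
  map_surjective f := by
    obtain ⟨g, hg⟩ := (HomotopyCategory.quotient (ProjCat Λ) (.up ℤ)).map_surjective f.hom
    exact ⟨ObjectProperty.homMk g, by ext; exact hg⟩

end Algebra

/-! ### Lengths of cells, and existence of indecomposable summands -/

/-- The length of a finitely generated projective right module, with value `0` if it is infinite
(which does not happen over an artinian ring). -/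
noncomputable def projSize (Λ : Type u) [Ring Λ] (P : ProjCat Λ) : ℕ :=
  (Module.length Λᵐᵒᵖ P.obj).toNat

section Artinian

variable {Λ : Type u} [Ring Λ] [IsArtinianRing Λᵐᵒᵖ]

theorem length_ne_top (P : ProjCat Λ) : Module.length Λᵐᵒᵖ P.obj ≠ ⊤ := by
  have := P.property.1
  exact Module.length_ne_top

theorem projSize_add {A B D : ProjCat Λ} (e : A ≅ B ⊞ D) :
    projSize Λ A = projSize Λ B + projSize Λ D := by
  have h : Module.length Λᵐᵒᵖ A.obj = Module.length Λᵐᵒᵖ D.obj + Module.length Λᵐᵒᵖ B.obj := by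
    let f : D ⟶ A := biprod.inr ≫ e.inv
    let f' : A ⟶ D := e.hom ≫ biprod.snd
    let g : A ⟶ B := e.hom ≫ biprod.fst
    let g' : B ⟶ A := biprod.inl ≫ e.inv
    have hf (x : D.obj) : f'.hom.hom (f.hom.hom x) = x := by
      have : f ≫ f' = 𝟙 _ := by simp [f, f']
      exact congr($(this).hom.hom x)
    have hg (x : B.obj) : g.hom.hom (g'.hom.hom x) = x := by
      have : g' ≫ g = 𝟙 _ := by simp [g, g']
      exact congr($(this).hom.hom x)
    have hfg (x : D.obj) : g.hom.hom (f.hom.hom x) = 0 := by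
      have : f ≫ g = 0 := by simp [f, g]
      exact congr($(this).hom.hom x)
    have ht (x : A.obj) : g'.hom.hom (g.hom.hom x) + f.hom.hom (f'.hom.hom x) = x := by
      have : g ≫ g' + f' ≫ f = 𝟙 _ := by
        have := e.hom ≫= (biprod.total (X := B) (Y := D) =≫ e.inv)
        simpa only [f, f', g, g', Preadditive.add_comp, Preadditive.comp_add, Category.assoc,
          Category.id_comp, e.hom_inv_id] using this
      exact congr($(this).hom.hom x)
    refine Module.length_eq_add_of_exact f.hom.hom g.hom.hom
      (Function.LeftInverse.injective hf) (fun x => ⟨_, hg x⟩) fun x => ⟨fun hx => ?_, ?_⟩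
    · exact ⟨f'.hom.hom x, by simpa [hx] using ht x⟩
    · rintro ⟨y, rfl⟩
      exact hfg y
  rw [projSize, h, ENat.toNat_add (length_ne_top D) (length_ne_top B), add_comm]
  rfl

theorem isZero_of_projSize_eq_zero {A : ProjCat Λ} (h : projSize Λ A = 0) : IsZero A := by
  rw [projSize, ENat.toNat_eq_zero, or_iff_left (length_ne_top A), Module.length_eq_zero_iff] at h
  rw [IsZero.iff_id_eq_zero]
  ext x
  exact Subsingleton.elim (α := A.obj) _ _

theorem exists_indecomposable_retract_projCat {P : ProjCat Λ} (hP : ¬ IsZero P) :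
    ∃ A : ProjCat Λ, Nonempty (Retract A P) ∧ Indecomposable A := by
  obtain ⟨A, a, hA, -⟩ := exists_indecomposable_retract (projSize Λ) projSize_add
    isZero_of_projSize_eq_zero (fun A => ¬ IsZero A) (fun {A B D} e h => by
      by_contra! h'
      exact h (IsZero.of_iso ((biprod_isZero_iff _ _).mpr h') e)) id P hP
  exact ⟨A, a, hA⟩

/-- A complex in `C_n(proj Λ)` that is nonzero in degree `j` has an indecomposable direct summand
that is nonzero in degree `j`. -/
theorem exists_indecomposable_retract_fixedSize {n : ℕ} {X : FixedSizeComplex Λ n} (j : ℤ)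
    (hX : ¬ IsZero (X.obj.X j)) :
    ∃ A : FixedSizeComplex Λ n,
      Nonempty (Retract A X) ∧ Indecomposable A ∧ ¬ IsZero (A.obj.X j) := by
  have cell (i : ℤ) {A B D : FixedSizeComplex Λ n} (e : A ≅ B ⊞ D) :
      Nonempty (A.obj.X i ≅ B.obj.X i ⊞ D.obj.X i) :=
    let F := (isFixedSize Λ n).ι ⋙ HomologicalComplex.eval (ProjCat Λ) (.up ℤ) i
    have : PreservesBinaryBiproducts F := preservesBinaryBiproducts_of_preservesBiproducts F
    ⟨F.mapIso e ≪≫ F.mapBiprod B D⟩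
  refine exists_indecomposable_retract
    (fun A => ∑ i ∈ Finset.Icc (1 : ℤ) n, projSize Λ (A.obj.X i))
    ?_ ?_ (fun A => ¬ IsZero (A.obj.X j)) ?_ ?_ X hX
  · intro A B D e
    rw [← Finset.sum_add_distrib]
    exact Finset.sum_congr rfl fun i _ => projSize_add (cell i e).some
  · intro A h
    rw [IsZero.iff_id_eq_zero]
    ext i : 2
    refine IsZero.eq_of_src ?_ _ _
    by_cases hi : i ∈ Finset.Icc (1 : ℤ) n
    · exact isZero_of_projSize_eq_zero (Finset.sum_eq_zero_iff.mp h i hi)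
    · exact A.property i (by rw [Finset.mem_Icc] at hi; omega)
  · intro A B D e h
    by_contra! h'
    exact h (IsZero.of_iso ((biprod_isZero_iff _ _).mpr h') (cell j e).some)
  · intro A h hA
    exact h (((isFixedSize Λ n).ι ⋙ HomologicalComplex.eval (ProjCat Λ) (.up ℤ) j).map_isZero hA)

end Artinian

/-! ### Truncations, and morphisms to the complexes `J_k(P)` -/

section Truncation

variable {C : Type u} [Category.{v} C] [HasZeroMorphisms C] [HasZeroObject C]

/-- The brutal truncation of a cochain complex `K` to the degrees `≤ n`: the quotient complex
`T`, with projection `π`, whose cells are those of `K` in the degrees `≤ n` and zero in the degrees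
`> n`. The sections `ι` of `π` commute with the differentials that end in a degree `≤ n`. -/
theorem exists_brutal_truncation (K : CochainComplex C ℤ) (n : ℤ) :
    ∃ (T : CochainComplex C ℤ) (π : K ⟶ T) (ι : ∀ i, T.X i ⟶ K.X i),
      (∀ i, ι i ≫ π.f i = 𝟙 _) ∧ (∀ i, i ≤ n → π.f i ≫ ι i = 𝟙 _) ∧
      (∀ i, n < i → IsZero (T.X i)) ∧
      ∀ i j, j ≤ n → T.d i j ≫ ι j = ι i ≫ K.d i j := by
  have (i : ℤ) : ∃ (X : C) (π : K.X i ⟶ X) (ι : X ⟶ K.X i), ι ≫ π = 𝟙 _ ∧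
      (i ≤ n → π ≫ ι = 𝟙 _) ∧ (n < i → IsZero X) := by
    obtain hi | hi := le_or_gt i n
    · exact ⟨K.X i, 𝟙 _, 𝟙 _, by simp, by simp, fun h => by omega⟩
    · obtain ⟨Z, hZ⟩ := HasZeroObject.zero (C := C)
      exact ⟨Z, 0, 0, hZ.eq_of_src _ _, fun h => by omega, fun _ => hZ⟩
  choose X π ι h₁ h₂ h₃ using this
  let T : CochainComplex C ℤ :=
    { X := X
      d := fun i j => ι i ≫ K.d i j ≫ π j
      shape := fun i j h => by simp [K.shape i j h]
      d_comp_d' := fun i j l _ _ => by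
        obtain hj | hj := le_or_gt j n
        · simp [reassoc_of% (h₂ j hj)]
        · rw [(h₃ j hj).eq_of_tgt (ι i ≫ K.d i j ≫ π j) 0, zero_comp] }
  refine ⟨T, { f := π, comm' := fun i j hij => ?_ }, ι, h₁, h₂, h₃, fun i j hj => ?_⟩
  · change π i ≫ ι i ≫ K.d i j ≫ π j = K.d i j ≫ π j
    obtain hi | hi := le_or_gt i n
    · rw [reassoc_of% (h₂ i hi)]
    · have hij : i + 1 = j := hij
      exact (h₃ j (by omega)).eq_of_tgt _ _
  · simp [T, h₂ j hj]

/-- A morphism from a cochain complex `K` to the complex `P ⟶ P` (identity) in the degrees `k` and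
`k + 1`, given by its component in degree `k + 1`. -/
theorem exists_hom_to_double {K : CochainComplex C ℤ} {P : C} {k : ℤ}
    (hk : (ComplexShape.up ℤ).Rel k (k + 1)) (φ : K.X (k + 1) ⟶ P) :
    ∃ g : K ⟶ HomologicalComplex.double (𝟙 P) hk,
      g.f k = K.d k (k + 1) ≫ φ ≫ (HomologicalComplex.doubleXIso₀ _ _).inv ∧
      g.f (k + 1) = φ ≫ (HomologicalComplex.doubleXIso₁ _ _ (by simp)).inv := by
  let D := HomologicalComplex.double (𝟙 P) hk
  let e₀ : D.X k ≅ P := HomologicalComplex.doubleXIso₀ _ _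
  let e₁ : D.X (k + 1) ≅ P := HomologicalComplex.doubleXIso₁ _ _ (by simp)
  let g (i : ℤ) : K.X i ⟶ D.X i :=
    if h₀ : i = k then K.d i (k + 1) ≫ φ ≫ e₀.inv ≫ eqToHom (by rw [h₀])
    else if h₁ : i = k + 1 then eqToHom (by rw [h₁]) ≫ φ ≫ e₁.inv ≫ eqToHom (by rw [h₁])
    else 0
  have hg₀ : g k = K.d k (k + 1) ≫ φ ≫ e₀.inv := by simp [g]
  have hg₁ : g (k + 1) = φ ≫ e₁.inv := by simp [g]
  refine ⟨{ f := g, comm' := fun i j hij => ?_ }, hg₀, hg₁⟩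
  obtain rfl : i + 1 = j := hij
  change g i ≫ D.d i (i + 1) = K.d i (i + 1) ≫ g (i + 1)
  by_cases h₀ : i = k
  · subst h₀
    have hd : D.d i (i + 1) = e₀.hom ≫ 𝟙 P ≫ e₁.inv := HomologicalComplex.double_d _ _ (by simp)
    rw [hg₀, hg₁, hd]
    simp
  · rw [HomologicalComplex.double_d_eq_zero₀ _ _ _ _ h₀, comp_zero]
    by_cases h₁ : i + 1 = k
    · subst h₁
      rw [hg₀]
      simp
    · rw [(HomologicalComplex.isZero_double_X _ _ (i + 1) h₁ (by omega)).eq_of_tgt (g (i + 1)) 0,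
        comp_zero]

end Truncation

/-! ### Contractible complexes -/

section Contractible

variable {Λ : Type u} [Ring Λ]

/-- If `K` is contractible and vanishes in degree `k + 2`, its differential from degree
`k` to degree `k + 1` is a split epimorphism, so that `J_k(P)` splits off for any direct summand `P`
of the cell in degree `k + 1`. -/
theorem exists_retract_J_of_homotopy {K : BoundedComplex Λ} (h : Homotopy (𝟙 K.obj) 0) {k : ℤ}
    (hK : IsZero (K.obj.X (k + 1 + 1))) {P : ProjCat Λ} (a : Retract P (K.obj.X (k + 1))) :
    Nonempty (Retract (J P k) K) := by
  have hk : (ComplexShape.up ℤ).Rel k (k + 1) := rfl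
  have hs : h.hom (k + 1) k ≫ K.obj.d k (k + 1) = 𝟙 _ := by
    have := h.comm (k + 1)
    rw [dNext_eq _ (show (ComplexShape.up ℤ).Rel (k + 1) (k + 1 + 1) from rfl), prevD_eq _ hk,
      hK.eq_of_tgt (K.obj.d (k + 1) (k + 1 + 1)) 0] at this
    simpa using this.symm
  obtain ⟨g, hg₀, hg₁⟩ := exists_hom_to_double (K := K.obj) hk a.r
  let i : HomologicalComplex.double (𝟙 P) hk ⟶ K.obj := HomologicalComplex.mkHomFromDouble hk
    (by simp) (a.i ≫ h.hom (k + 1) k) a.i (by simp [hs]) (fun j hj => by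
      obtain rfl : k + 1 + 1 = j := hj
      exact hK.eq_of_tgt _ _)
  have hig : i ≫ g = 𝟙 _ := by
    apply HomologicalComplex.from_double_hom_ext
    · rw [HomologicalComplex.comp_f, hg₀, HomologicalComplex.mkHomFromDouble_f₀]
      simp [reassoc_of% hs]
    · rw [HomologicalComplex.comp_f, hg₁, HomologicalComplex.mkHomFromDouble_f₁]
      simp
  exact ⟨⟨ObjectProperty.homMk i, ObjectProperty.homMk g, by ext : 1; exact hig⟩⟩

theorem isZero_of_forall_isZero {K : BoundedComplex Λ} (h : ∀ i, IsZero (K.obj.X i)) :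
    IsZero K := by
  rw [IsZero.iff_id_eq_zero]
  ext i : 2
  exact (h i).eq_of_src _ _

theorem isZero_X {K : BoundedComplex Λ} (h : IsZero K) (i : ℤ) : IsZero (K.obj.X i) :=
  ((isBounded Λ).ι ⋙ HomologicalComplex.eval (ProjCat Λ) (.up ℤ) i).map_isZero h

variable [IsArtinianRing Λᵐᵒᵖ]

/-- A nonzero contractible complex has an indecomposable projective direct summand, so no such
complex is a direct summand of a complex without indecomposable projective direct summands. -/
theorem isZero_of_retract_of_isZero_toHo {X Y : BoundedComplex Λ} (hX : HasNoProjectiveSummand X)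
    (a : Retract Y X) (hY : IsZero ((toHo Λ).obj Y)) : IsZero Y := by
  by_contra hY₀
  obtain ⟨r, s, hrs⟩ := Y.property
  obtain ⟨m, hm⟩ : ∃ m, ¬ IsZero (Y.obj.X m) := by
    by_contra! h
    exact hY₀ (isZero_of_forall_isZero h)
  obtain ⟨t, ht, htm⟩ := Int.exists_greatest_of_bdd (P := fun i => ¬ IsZero (Y.obj.X i))
    ⟨s, fun i hi => by
      by_contra! h
      exact hi (hrs i (.inr h))⟩ ⟨m, hm⟩
  obtain ⟨k, rfl⟩ : ∃ k, t = k + 1 := ⟨t - 1, by omega⟩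
  have hh : Nonempty (Homotopy (𝟙 Y.obj) 0) := by
    rw [← HomotopyCategory.isZero_quotient_obj_iff]
    exact (isHoBounded Λ).ι.map_isZero hY
  obtain ⟨P, ⟨p⟩, hP⟩ := exists_indecomposable_retract_projCat ht
  obtain ⟨b⟩ := exists_retract_J_of_homotopy hh.some (by
    by_contra h
    have := htm _ h
    omega) p
  exact hX P k hP (exists_iso_biprod_of_retract (b.trans a))

end Contractible

/-! ### Fitting's lemma -/

section Fitting

variable {Λ : Type u} [Ring Λ] [IsArtinianRing Λᵐᵒᵖ]

/-- Fitting's lemma for bounded complexes: the decompositions of the cells into the kernel and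
the range of a high power of `f` are compatible with the differentials. -/
theorem isIso_or_pow_eq_zero {K : ProjComplex Λ} {r s : ℤ} (hK : VanishesOutside K r s)
    (h : HasTrivialIdempotents K) (f : End K) : IsIso (X := K) (Y := K) f ∨ ∃ n : ℕ, f ^ n = 0 := by
  let F (i : ℤ) : Module.End Λᵐᵒᵖ (K.X i).obj := (f.f i).hom.hom
  have hF (n : ℕ) (i : ℤ) : (HomologicalComplex.Hom.f (f ^ n) i).hom.hom = F i ^ n := by
    induction n with
    | zero => rfl
    | succ n ih =>
      rw [pow_succ, pow_succ, ← ih]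
      rfl
  -- One exponent serves for the finitely many nonzero cells; it is positive, so that
  -- `f` is a unit if `f ^ n` is.
  obtain ⟨n, hn₀, hn⟩ : ∃ n : ℕ, 1 ≤ n ∧ ∀ i ∈ Finset.Icc r s,
      IsCompl (LinearMap.ker (F i ^ n)) (LinearMap.range (F i ^ n)) := by
    refine ((Filter.eventually_ge_atTop 1).and
      ((Filter.eventually_all_finset _).mpr fun i _ => ?_)).exists
    have := (K.X i).property.1
    exact (F i).eventually_isCompl_ker_pow_range_pow
  have hc (i : ℤ) : IsCompl (LinearMap.range (F i ^ n)) (LinearMap.ker (F i ^ n)) := by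
    by_cases hi : i ∈ Finset.Icc r s
    · exact (hn i hi).symm
    · have : Subsingleton (K.X i).obj := by
        have := (isFinProj Λ).ι.map_isZero (hK i (by rw [Finset.mem_Icc] at hi; omega))
        exact ModuleCat.subsingleton_of_isZero this
      exact ⟨disjoint_iff.mpr (Subsingleton.elim _ _), codisjoint_iff.mpr (Subsingleton.elim _ _)⟩
  -- The projections to the ranges along the kernels form an idempotent endomorphism of `K`.
  let π (i : ℤ) : Module.End Λᵐᵒᵖ (K.X i).obj := Submodule.projection _ _ (hc i)
  let e : K ⟶ K :=
    { f := fun i => ObjectProperty.homMk (ModuleCat.ofHom (π i))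
      comm' := fun i j _ => by
        ext x
        change (K.d i j).hom.hom (π i x) = π j ((K.d i j).hom.hom x)
        have hd (y : (K.X i).obj) :
            (F j ^ n) ((K.d i j).hom.hom y) = (K.d i j).hom.hom ((F i ^ n) y) := by
          rw [← hF, ← hF]
          exact congr($((HomologicalComplex.Hom.comm (f ^ n) i j).symm).hom.hom y)
        obtain ⟨_, ⟨y, rfl⟩, b, hb, rfl⟩ :=
          Submodule.mem_sup.mp ((hc i).sup_eq_top ▸ Submodule.mem_top (x := x))
        rw [map_add, map_add, map_add, map_add,
          Submodule.projection_apply_of_mem_left (hc i) ⟨y, rfl⟩,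
          Submodule.projection_apply_of_mem_right (hc i) hb,
          Submodule.projection_apply_of_mem_left (hc j) ⟨_, hd y⟩,
          Submodule.projection_apply_of_mem_right (hc j) (by
            rw [LinearMap.mem_ker, hd, LinearMap.mem_ker.mp hb, map_zero]), map_zero] }
  have he : e ≫ e = e := by
    ext i x
    exact Submodule.projection_apply_of_mem_left (hc i) (Submodule.projection_apply_mem _ _)
  have heπ (i : ℤ) (x : (K.X i).obj) : π i x = (e.f i).hom.hom x := rfl
  rcases h e he with h | h
  · right
    refine ⟨n, ?_⟩
    apply HomologicalComplex.hom_ext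
    intro i
    ext x
    rw [hF]
    have := Submodule.projection_apply_of_mem_left (hc i) ⟨x, rfl⟩
    change π i _ = _ at this
    rw [heπ, h] at this
    exact this.symm
  · left
    have hid (i : ℤ) (x : (K.X i).obj) : π i x = x := by
      rw [heπ, h]
      rfl
    rw [← isUnit_iff_isIso, ← isUnit_pow_iff (by omega : n ≠ 0), isUnit_iff_isIso]
    have (i : ℤ) : IsIso (HomologicalComplex.Hom.f (f ^ n) i) := by
      rw [← isIso_iff_of_reflects_iso _ ((isFinProj Λ).ι ⋙ forget (ModuleCat Λᵐᵒᵖ)),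
        isIso_iff_bijective]
      change Function.Bijective (HomologicalComplex.Hom.f (f ^ n) i).hom.hom
      rw [hF]
      refine ⟨LinearMap.ker_eq_bot.mp (LinearMap.ker_eq_bot'.mpr fun x hx => ?_), fun x => ?_⟩
      · rw [← hid i x]
        exact Submodule.projection_apply_of_mem_right (hc i) hx
      · have : π i x ∈ LinearMap.range (F i ^ n) := Submodule.projection_apply_mem _ _
        rwa [hid] at this
    exact HomologicalComplex.Hom.isIso_of_components _

end Fitting

/-! ### Indecomposability in the bounded and in the homotopy category -/

section Indecomposable

variable {Λ : Type u} [Ring Λ]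

theorem not_isZero_J {P : ProjCat Λ} {k : ℤ} (hP : ¬ IsZero P) : ¬ IsZero (J P k) :=
  fun h => hP ((isZero_X h k).of_iso (HomologicalComplex.doubleXIso₀ (𝟙 P)
    (show (ComplexShape.up ℤ).Rel k (k + 1) from rfl)).symm)

/-- An indecomposable complex that is nonzero in the degrees `1` and `n ≥ 3` is none of the
`J_k(P)`, which live in two consecutive degrees. -/
theorem hasNoProjectiveSummand_of_three_le {Y : BoundedComplex Λ} (h : Indecomposable Y)
    {n : ℤ} (hn : 3 ≤ n) (h₁ : ¬ IsZero (Y.obj.X 1)) (hYn : ¬ IsZero (Y.obj.X n)) :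
    HasNoProjectiveSummand Y := by
  rintro P k hP ⟨Z, ⟨e⟩⟩
  have hZ := (h.2 _ _ e).resolve_left (not_isZero_J hP.1)
  obtain ⟨φ⟩ := (hasTrivialIdempotents_of_indecomposable h).nonempty_iso_of_retract
    (A := J P k) ⟨biprod.inl ≫ e.inv, e.hom ≫ biprod.fst, by simp⟩ (not_isZero_J hP.1)
  have (i : ℤ) (hi : ¬ IsZero (Y.obj.X i)) : i = k ∨ i = k + 1 := by
    by_contra! hik
    exact hi ((HomologicalComplex.isZero_double_X (𝟙 P)
      (show (ComplexShape.up ℤ).Rel k (k + 1) from rfl) i hik.1 hik.2).of_iso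
      (((isBounded Λ).ι ⋙ HomologicalComplex.eval (ProjCat Λ) (.up ℤ) i).mapIso φ.symm))
  have h₁ := this 1 h₁
  have hn := this n hYn
  omega

variable [IsArtinianRing Λᵐᵒᵖ]

/-- A complex without indecomposable projective summands is indecomposable if its homotopy class
is: a direct summand that vanishes in the homotopy category is contractible, hence zero. -/
theorem hasTrivialIdempotents_of_indecomposable_toHo {Y : BoundedComplex Λ}
    (hY : HasNoProjectiveSummand Y) (h : Indecomposable ((toHo Λ).obj Y)) :
    HasTrivialIdempotents Y := by
  refine hasTrivialIdempotents_of_indecomposable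
    ⟨fun h₀ => h.1 ((toHo Λ).map_isZero h₀), fun A B e => ?_⟩
  have a : Retract A Y := ⟨biprod.inl ≫ e.inv, e.hom ≫ biprod.fst, by simp⟩
  have b : Retract B Y := ⟨biprod.inr ≫ e.inv, e.hom ≫ biprod.snd, by simp⟩
  have : PreservesBinaryBiproducts (toHo Λ) := preservesBinaryBiproducts_of_preservesBiproducts _
  exact (h.2 _ _ ((toHo Λ).mapIso e ≪≫ (toHo Λ).mapBiprod A B)).imp
    (isZero_of_retract_of_isZero_toHo hY a) (isZero_of_retract_of_isZero_toHo hY b)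

/-- Conversely, an idempotent of the homotopy class of an indecomposable complex lifts to an
endomorphism, which is invertible or nilpotent by Fitting's lemma. No splitting of idempotents in
the homotopy category is needed. -/
theorem indecomposable_toHo {Y : BoundedComplex Λ} (hY : HasNoProjectiveSummand Y)
    (h : Indecomposable Y) : Indecomposable ((toHo Λ).obj Y) := by
  have hY' := hasTrivialIdempotents_of_indecomposable h
  refine HasTrivialIdempotents.indecomposable (fun e he => ?_) fun h₀ =>
    h.1 (isZero_of_retract_of_isZero_toHo hY (Retract.refl Y) h₀)
  obtain ⟨f, rfl⟩ := (toHo Λ).map_surjective e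
  obtain ⟨r, s, hrs⟩ := Y.property
  rcases isIso_or_pow_eq_zero hrs (hY'.of_fullyFaithful (isBounded Λ).ι) f.hom with hf | ⟨n, hn⟩
  · right
    have : IsIso f := (isIso_iff_of_reflects_iso f (isBounded Λ).ι).mp hf
    rw [← cancel_epi ((toHo Λ).map f), he, Category.comp_id]
  · left
    let g : End Y.obj := f.hom
    have hg (n : ℕ) : (toHo Λ).map (ObjectProperty.homMk (g ^ (n + 1))) = (toHo Λ).map f := by
      induction n with
      | zero =>
        rw [zero_add, pow_one]
        rfl
      | succ n ih =>
        rw [pow_succ]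
        change (toHo Λ).map (f ≫ ObjectProperty.homMk (g ^ (n + 1))) = _
        rw [Functor.map_comp, ih, he]
    have hn' : g ^ (n + 1) = 0 := by rw [pow_succ, hn, zero_mul]
    rw [← hg n, hn']
    exact (toHo Λ).map_zero _ _

end Indecomposable

/-! ### Comparison of the lengths with the sizes of indecomposable complexes -/

section Comparison

variable {Λ : Type u} [Ring Λ] [IsArtinianRing Λᵐᵒᵖ]

/-- If an indecomposable complex is nonzero in the degrees `1` and `m` and zero outside `1, …, m`,
then for `1 ≤ n ≤ m` a direct summand of its truncation to `1, …, n` is indecomposable and nonzero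
in the degrees `1` and `n`. -/
theorem exists_indecomposable_fixedSize {K : ProjComplex Λ} (hK : HasTrivialIdempotents K)
    {m n : ℕ} (hKm : VanishesOutside K 1 m) (h₁ : ¬ IsZero (K.X 1)) (hm : ¬ IsZero (K.X m))
    (hn : 1 ≤ n) (hnm : n ≤ m) : ∃ A : FixedSizeComplex Λ n,
      Indecomposable A ∧ ¬ IsZero (A.obj.X 1) ∧ ¬ IsZero (A.obj.X n) := by
  obtain ⟨T, π, ι, hιπ, hπι, hT, hd⟩ := exists_brutal_truncation K n
  have hTn : VanishesOutside T 1 n := by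
    rintro i (hi | hi)
    · exact isZero_of_retract ⟨ι i, π.f i, hιπ i⟩ (hKm i (.inl hi))
    · exact hT i hi
  have hT₁ : ¬ IsZero (T.X 1) := fun h =>
    h₁ (isZero_of_retract ⟨π.f 1, ι 1, hπι 1 (by omega)⟩ h)
  obtain ⟨A, ⟨a⟩, hA, hA₁⟩ := exists_indecomposable_retract_fixedSize (X := ⟨T, hTn⟩) 1 hT₁
  refine ⟨A, hA, hA₁, fun hAn => ?_⟩
  -- If `A` ends before degree `n`, its inclusion into the truncation lifts to `K`.
  let i : A.obj ⟶ K :=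
    { f := fun i => a.i.hom.f i ≫ ι i
      comm' := fun i j hij => by
        obtain rfl : i + 1 = j := hij
        obtain hj | hj := le_or_gt (i + 1) n
        · have := a.i.hom.comm i (i + 1)
          simp only [Category.assoc, ← hd i _ hj, reassoc_of% this]
        · refine IsZero.eq_of_src ?_ _ _
          obtain rfl | hi := (show (n : ℤ) ≤ i by omega).eq_or_lt
          · exact hAn
          · exact A.property i (.inr hi) }
  have hi : i ≫ π ≫ a.r.hom = 𝟙 _ := by
    ext j : 1
    have := congr($(a.retract).hom.f j)
    change a.i.hom.f j ≫ a.r.hom.f j = 𝟙 _ at this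
    change (a.i.hom.f j ≫ ι j) ≫ π.f j ≫ a.r.hom.f j = 𝟙 _
    rw [Category.assoc, reassoc_of% (hιπ j), this]
  obtain ⟨e⟩ := hK.nonempty_iso_of_retract ⟨i, π ≫ a.r.hom, hi⟩ fun h =>
    hA₁ ((HomologicalComplex.eval _ _ 1).map_isZero h)
  refine hm (IsZero.of_iso ?_ ((HomologicalComplex.eval _ _ (m : ℤ)).mapIso e.symm))
  obtain h | h := hnm.eq_or_lt
  · rw [← h]
    exact hAn
  · exact A.property m (.inr (by omega))

theorem exists_hasLength {n : ℕ} (hn : 3 ≤ n) {X : FixedSizeComplex Λ n} (hX : Indecomposable X)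
    (h₁ : ¬ IsZero (X.obj.X 1)) (hXn : ¬ IsZero (X.obj.X n)) :
    ∃ Z : HoBounded Λ, Indecomposable Z ∧ HasLength Z (n - 1) := by
  let Y : BoundedComplex Λ := ⟨X.obj, 1, n, X.property⟩
  have hY : Indecomposable Y := HasTrivialIdempotents.indecomposable
    (.of_map (isBounded Λ).ι
      ((hasTrivialIdempotents_of_indecomposable hX).of_fullyFaithful (isFixedSize Λ n).ι))
    fun h => h₁ (isZero_X h 1)
  have hY' : HasNoProjectiveSummand Y :=
    hasNoProjectiveSummand_of_three_le hY (by omega) h₁ hXn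
  exact ⟨_, indecomposable_toHo hY' hY, Y, 1, n, ⟨Iso.refl _⟩, hY', h₁, hXn, X.property, by omega⟩

/-- The shift by `r - 1` moves a complex in the degrees `r, …, r + l` to the degrees
`1, …, l + 1`. -/
theorem exists_indecomposable_of_hasLength {Z : HoBounded Λ} (hZ : Indecomposable Z) {l n : ℕ}
    (hl : HasLength Z l) (hn : 1 ≤ n) (hnl : n ≤ l + 1) : ∃ A : FixedSizeComplex Λ n,
      Indecomposable A ∧ ¬ IsZero (A.obj.X 1) ∧ ¬ IsZero (A.obj.X n) := by
  obtain ⟨Y, r, s, ⟨e⟩, hY, hr, hs, hrs, hl⟩ := hl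
  have := (hasTrivialIdempotents_of_indecomposable_toHo hY
    (indecomposable_of_iso e.symm hZ)).of_fullyFaithful
      ((isBounded Λ).ι ⋙ CategoryTheory.shiftFunctor (ProjComplex Λ) (r - 1))
  refine exists_indecomposable_fixedSize this (m := l + 1) (fun i hi => ?_) ?_ ?_ hn hnl
  · exact hrs (i + (r - 1)) (by omega)
  · change ¬ IsZero (Y.obj.X (1 + (r - 1)))
    rwa [add_sub_cancel]
  · change ¬ IsZero (Y.obj.X ((l + 1 : ℕ) + (r - 1)))
    rwa [show ((l + 1 : ℕ) + (r - 1) : ℤ) = s by omega]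

theorem sgldim_eq_m₀_sub_two (hΛ : 1 ≤ sgldim Λ) : sgldim Λ = m₀ Λ - 2 := by
  -- Each length `l` gives, for all `n ≤ l + 1`, a complex that fails the condition in `m₀`.
  have add_two_le {Z : HoBounded Λ} (hZ : Indecomposable Z) {l n : ℕ} (hl : HasLength Z l)
      (hn₂ : 2 ≤ n) (hn : ∀ X : FixedSizeComplex Λ n, Indecomposable X →
        IsZero (X.obj.X 1) ∨ IsZero (X.obj.X n)) : l + 2 ≤ n := by
    by_contra! h
    obtain ⟨A, hA, h₁, h₂⟩ := exists_indecomposable_of_hasLength hZ hl (n := n)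
      (by omega) (by omega)
    exact (hn A hA).elim h₁ h₂
  apply le_antisymm
  · refine sSup_le ?_
    rintro _ ⟨Z, l, hZ, hl, rfl⟩
    refine (ENat.addLECancellable_of_ne_top (by simp)).le_tsub_of_add_le_right ?_
    refine le_sInf ?_
    rintro _ ⟨n, hn₂, hn, rfl⟩
    exact_mod_cast add_two_le hZ hl hn₂ hn
  · induction h : sgldim Λ using ENat.recTopCoe with
    | top => exact le_top
    | coe L =>
      rw [h] at hΛ
      have hL : 1 ≤ L := by exact_mod_cast hΛ
      rw [tsub_le_iff_right]
      -- As `L + 2 ≥ 3`, a complex that fails the condition for `n = L + 2` has length `L + 1`.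
      refine sInf_le ⟨L + 2, by omega, fun X hX => ?_, by simp⟩
      by_contra! hX'
      obtain ⟨Z, hZ, hl⟩ := exists_hasLength (by omega) hX hX'.1 hX'.2
      have : ((L + 2 - 1 : ℕ) : ℕ∞) ≤ sgldim Λ := le_sSup ⟨Z, _, hZ, hl, rfl⟩
      rw [h] at this
      have : L + 2 - 1 ≤ L := by exact_mod_cast this
      omega

end Comparison

end StrongGlDim

theorem theorem3p22 (k : Type w) [Field k] (Λ : Type u) [Ring Λ] [Algebra k Λ] [Module.Finite k Λ]
    (hΛ : 1 ≤ StrongGlDim.sgldim Λ) :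
    StrongGlDim.sgldim Λ = StrongGlDim.m₀ Λ - 2 := by
  have : Module.Finite k Λᵐᵒᵖ := Module.Finite.equiv (MulOpposite.opLinearEquiv k)
  have : IsArtinianRing Λᵐᵒᵖ := IsArtinianRing.of_finite k Λᵐᵒᵖ
  exact StrongGlDim.sgldim_eq_m₀_sub_two hΛ
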